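/- For $\epsilon,\epsilon'\in\mathbb{R}$, $\zeta\in\mathbb{C}$ and $\tau$ in the upper half plane $\mathbb{H}^2=\{\tau\in\mathbb{C} : \operatorname{Im}\tau>0\}$, let $$\theta\begin{bmatrix}\epsilon\\ \epsilon'\end{bmatrix}(\zeta,\tau)=\sum_{n\in\mathbb{Z}}\exp\left(2\pi i\left[\tfrac12\left(n+\tfrac{\epsilon}{2}\right)^2\tau+\left(n+\tfrac{\epsilon}{2}\right)\left(\zeta+\tfrac{\epsilon'}{2}\right)\right]\right),$$ and write $\theta\begin{bmatrix}\epsilon\\ \epsilon'\end{bmatrix}$, $\theta'\begin{bmatrix}\epsilon\\ \epsilon'\end{bmatrix}$, $\theta''\begin{bmatrix}\epsilon\\ \epsilon'\end{bmatrix}$ for the values at $\zeta=0$ of this function and of its first and second partial derivatives with respect to $\zeta$, respectively. Then for every $\tau\in\mathbb{H}^2$ the theta constants $\theta\begin{bmatrix}1\\ 1/5\end{bmatrix}$ and $\theta\begin{bmatrix}1\\ 3/5\end{bmatrix}$ are nonzero, and $$\frac{\theta''\begin{bmatrix}1\\ 1/5\end{bmatrix}}{\theta\begin{bmatrix}1\\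 1/5\end{bmatrix}}-\frac{\theta''\begin{bmatrix}1\\ 3/5\end{bmatrix}}{\theta\begin{bmatrix}1\\ 3/5\end{bmatrix}}=\frac{\left\{\theta'\begin{bmatrix}1\\ 1\end{bmatrix}\right\}^2}{100\,\theta^6\begin{bmatrix}1\\ 1/5\end{bmatrix}\theta^6\begin{bmatrix}1\\ 3/5\end{bmatrix}}\left\{-8\,\theta^{10}\begin{bmatrix}1\\ 1/5\end{bmatrix}+88\,\theta^5\begin{bmatrix}1\\ 1/5\end{bmatrix}\theta^5\begin{bmatrix}1\\ 3/5\end{bmatrix}+8\,\theta^{10}\begin{bmatrix}1\\ 3/5\end{bmatrix}\right\}.$$ -/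

import Mathlib

/-- The theta function with characteristics `ε, ε'` (Farkas-Kra normalisation):
`θ[ε; ε'](ζ, τ) = ∑_{n ∈ ℤ} exp (2πi (½ (n + ε/2)² τ + (n + ε/2) (ζ + ε'/2)))`. -/
noncomputable def thetaChar (ε ε' : ℝ) (ζ : ℂ) (τ : UpperHalfPlane) : ℂ :=
  ∑' n : ℤ, Complex.exp (2 * (Real.pi : ℂ) * Complex.I *
    ((1 / 2 : ℂ) * ((n : ℂ) + (ε : ℂ) / 2) ^ 2 * (τ : ℂ)
      + ((n : ℂ) + (ε : ℂ) / 2) * (ζ + (ε' : ℂ) / 2)))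

/-- The theta constant `θ[ε; ε'] = θ[ε; ε'](0, τ)`. -/
noncomputable def thetaConst (ε ε' : ℝ) (τ : UpperHalfPlane) : ℂ :=
  thetaChar ε ε' 0 τ

/-- The derivative coefficient `θ'[ε; ε'] = ∂/∂ζ θ[ε; ε'](ζ, τ)` at `ζ = 0`. -/
noncomputable def thetaDeriv (ε ε' : ℝ) (τ : UpperHalfPlane) : ℂ :=
  deriv (fun ζ : ℂ => thetaChar ε ε' ζ τ) 0

/-- The derivative coefficient `θ''[ε; ε'] = ∂²/∂ζ² θ[ε; ε'](ζ, τ)` at `ζ = 0`. -/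
noncomputable def thetaDeriv2 (ε ε' : ℝ) (τ : UpperHalfPlane) : ℂ :=
  iteratedDeriv 2 (fun ζ : ℂ => thetaChar ε ε' ζ τ) 0

/-- The general term of the theta series, in terms of the two-variable Jacobi theta series. -/
theorem thetaChar_term_eq (ε ε' : ℝ) (ζ : ℂ) (τ : UpperHalfPlane) (n : ℤ) :
    Complex.exp (2 * (Real.pi : ℂ) * Complex.I *
      ((1 / 2 : ℂ) * ((n : ℂ) + (ε : ℂ) / 2) ^ 2 * (τ : ℂ)
        + ((n : ℂ) + (ε : ℂ) / 2) * (ζ + (ε' : ℂ) / 2))) =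
    Complex.exp (2 * (Real.pi : ℂ) * Complex.I *
      ((ε : ℂ) ^ 2 / 8 * (τ : ℂ) + (ε : ℂ) / 2 * (ζ + (ε' : ℂ) / 2))) *
    jacobiTheta₂_term n (ζ + (ε' : ℂ) / 2 + (ε : ℂ) / 2 * (τ : ℂ)) (τ : ℂ) := by
  rw [jacobiTheta₂_term, ← Complex.exp_add]
  congr 1
  ring

/-- The theta series converges (absolutely) for every `ζ` and every `τ` in the upper half plane. -/
theorem summable_thetaChar (ε ε' : ℝ) (ζ : ℂ) (τ : UpperHalfPlane) :
    Summable (fun n : ℤ => Complex.exp (2 * (Real.pi : ℂ) * Complex.I *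
      ((1 / 2 : ℂ) * ((n : ℂ) + (ε : ℂ) / 2) ^ 2 * (τ : ℂ)
        + ((n : ℂ) + (ε : ℂ) / 2) * (ζ + (ε' : ℂ) / 2)))) := by
  simp only [thetaChar_term_eq]
  exact ((summable_jacobiTheta₂_term_iff _ _).2 τ.im_pos).mul_left _

/-- The theta function is entire in `ζ`, so its derivative coefficients are genuine derivatives. -/
theorem differentiable_thetaChar (ε ε' : ℝ) (τ : UpperHalfPlane) :
    Differentiable ℂ (fun ζ : ℂ => thetaChar ε ε' ζ τ) := by
  simp only [thetaChar, thetaChar_term_eq, tsum_mul_left]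
  refine Differentiable.mul (by fun_prop) ?_
  intro ζ
  have h := DifferentiableAt.comp (g := fun x => jacobiTheta₂ x (τ : ℂ))
    (f := fun z : ℂ => z + (ε' : ℂ) / 2 + (ε : ℂ) / 2 * (τ : ℂ)) ζ
    (differentiableAt_jacobiTheta₂_fst _ τ.im_pos) (by fun_prop)
  exact h

open Complex

/-! Write t for `oddTheta`. Since θ[1; e](z) = t(z + (e − 1)/2), both theta constants are, up to
sign, the values t(2/5) and t(1/5), and everything follows from the three-term identity for t
(`oddTheta_three_term`). Differentiated twice, it expresses (log t)''(a) − (log t)''(b) through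
values of t and t'(0) (`oddTheta_logDeriv_sub`). A specialisation differentiated once relates t'/t
at a and 3a (`oddTheta_triple`). For a = 1/5 and 2/5, parity and t(z + 1) = −t(z) bring 3a back to
these two points, so t'/t is found there by linear algebra; then t''/t = (log t)'' + (t'/t)² gives
the formula. The same identity puts the zeros of t in the lattice (`oddTheta_eq_zero`), hence the
nonvanishing. -/

/-- The general term of the series of `thetaChar 1 1`. -/
noncomputable def oddThetaTerm (τ z : ℂ) (n : ℤ) : ℂ :=
  exp (Real.pi * I * ((n : ℂ) + 1 / 2) ^ 2 * τ + 2 * Real.pi * I * ((n : ℂ) + 1 / 2) * (z + 1 / 2))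

/-- The odd theta function `θ[1; 1]`. -/
noncomputable def oddTheta (τ : UpperHalfPlane) (z : ℂ) : ℂ := thetaChar 1 1 z τ

theorem HasSum.of_eq {ι : Type*} {f g : ι → ℂ} {a b : ℂ} (h : HasSum f a) (hf : ∀ n, g n = f n)
    (ha : b = a) : HasSum g b := by
  rw [ha, funext hf]
  exact h

/-! ### Parity and quasi-periods of the odd theta function -/

theorem exp_half_int_mul (n : ℤ) : exp (2 * Real.pi * I * ((n : ℂ) + 1 / 2)) = -1 := by
  rw [show 2 * Real.pi * I * ((n : ℂ) + 1 / 2) = n * (2 * Real.pi * I) + Real.pi * I by ring,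
    exp_add, exp_int_mul_two_pi_mul_I, exp_pi_mul_I, one_mul]

theorem hasSum_oddTheta (τ : UpperHalfPlane) (z : ℂ) :
    HasSum (oddThetaTerm τ z) (oddTheta τ z) := by
  have h := (summable_thetaChar 1 1 z τ).hasSum
  refine h.of_eq (fun n => ?_) rfl
  rw [oddThetaTerm]
  congr 1
  push_cast
  ring

theorem differentiable_oddTheta (τ : UpperHalfPlane) : Differentiable ℂ (oddTheta τ) :=
  differentiable_thetaChar 1 1 τ

theorem thetaChar_one_eq (τ : UpperHalfPlane) (e : ℝ) (z : ℂ) :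
    thetaChar 1 e z τ = oddTheta τ (z + ((e : ℂ) - 1) / 2) := by
  rw [← (hasSum_oddTheta τ _).tsum_eq, thetaChar]
  refine tsum_congr fun n => ?_
  rw [oddThetaTerm]
  congr 1
  push_cast
  ring

/-- The reindexing n ↦ −1 − n negates n + 1/2; the sign comes from the shift of z by 1/2. -/
theorem oddTheta_neg (τ : UpperHalfPlane) (z : ℂ) : oddTheta τ (-z) = -oddTheta τ z := by
  have h := (Equiv.subLeft (-1 : ℤ)).hasSum_iff.2 (hasSum_oddTheta τ (-z))
  refine h.unique ?_
  refine (hasSum_oddTheta τ z).neg.of_eq (fun n => ?_) rfl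
  have e := exp_half_int_mul (-1 - n)
  simp only [Function.comp, Equiv.subLeft_apply, oddThetaTerm]
  rw [show -exp (Real.pi * I * ((n : ℂ) + 1 / 2) ^ 2 * τ
      + 2 * Real.pi * I * ((n : ℂ) + 1 / 2) * (z + 1 / 2)) = (-1) * exp (Real.pi * I *
      ((n : ℂ) + 1 / 2) ^ 2 * τ + 2 * Real.pi * I * ((n : ℂ) + 1 / 2) * (z + 1 / 2)) by ring,
    ← e, ← exp_add]
  congr 1
  push_cast
  ring

theorem oddTheta_add_one (τ : UpperHalfPlane) (z : ℂ) :
    oddTheta τ (z + 1) = -oddTheta τ z := by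
  refine (hasSum_oddTheta τ (z + 1)).unique ?_
  refine ((hasSum_oddTheta τ z).mul_left (-1)).of_eq (fun n => ?_) (by ring)
  · rw [← exp_half_int_mul n, oddThetaTerm, oddThetaTerm, ← exp_add]
    congr 1
    ring

theorem oddTheta_add_tau (τ : UpperHalfPlane) (z : ℂ) :
    oddTheta τ (z + τ) = -exp (-(Real.pi * I * τ) - 2 * Real.pi * I * z) * oddTheta τ z := by
  have h := (Equiv.addRight (1 : ℤ)).hasSum_iff.2 (hasSum_oddTheta τ z)
  refine (hasSum_oddTheta τ (z + τ)).unique ?_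
  refine (h.mul_left (-exp (-(Real.pi * I * τ) - 2 * Real.pi * I * z))).of_eq (fun n => ?_) rfl
  have e : -exp (-(Real.pi * I * (τ : ℂ)) - 2 * Real.pi * I * z) =
      exp (Real.pi * I + (-(Real.pi * I * τ) - 2 * Real.pi * I * z)) := by
    rw [exp_add, exp_pi_mul_I]; ring
  simp only [Function.comp, Equiv.coe_addRight, oddThetaTerm]
  rw [e, ← exp_add, ← exp_periodic]
  congr 1
  push_cast
  ring

theorem oddTheta_one_sub (τ : UpperHalfPlane) (z : ℂ) : oddTheta τ (1 - z) = oddTheta τ z := by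
  rw [show 1 - z = -z + 1 by ring, oddTheta_add_one, oddTheta_neg, neg_neg]

theorem oddTheta_zero (τ : UpperHalfPlane) : oddTheta τ 0 = 0 := by
  have := oddTheta_neg τ 0
  rw [neg_zero] at this
  linear_combination this / 2

/-! ### The three-term identity -/

/-- The general term of the two theta series of doubled period. -/
noncomputable def quadTerm (τ x : ℂ) (p : ℤ) : ℂ :=
  exp (Real.pi * I * τ * p ^ 2 / 2 + 2 * Real.pi * I * p * x)

theorem summable_quadTerm (τ : UpperHalfPlane) (x : ℂ) : Summable (quadTerm τ x) := by
  have h : 0 < ((τ : ℂ) / 2).im := by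
    have := τ.im_pos
    simpa using this
  convert (summable_jacobiTheta₂_term_iff x ((τ : ℂ) / 2)).2 h using 1
  ext n
  rw [quadTerm, jacobiTheta₂_term]
  congr 1
  ring

/-- The even-index part of the theta series of doubled period. -/
noncomputable def evenPart (τ x : ℂ) : ℂ := ∑' k : ℤ, quadTerm τ x (2 * k)

/-- The odd-index part of the theta series of doubled period. -/
noncomputable def oddPart (τ x : ℂ) : ℂ := ∑' k : ℤ, quadTerm τ x (2 * k + 1)

theorem oddThetaTerm_mul (τ x y : ℂ) (m n : ℤ) :
    oddThetaTerm τ (x + y) m * oddThetaTerm τ (x - y) n =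
      exp (Real.pi * I * (m + n + 1 : ℤ)) *
        (quadTerm τ x (m + n + 1) * quadTerm τ y (m - n)) := by
  simp only [oddThetaTerm, quadTerm, ← exp_add]
  congr 1
  push_cast
  ring

/-- In the double series over (m, n), the new indices m + n + 1 and m − n have opposite parity; the
sign is that of (−1)^(m + n + 1). -/
theorem oddTheta_mul (τ : UpperHalfPlane) (x y : ℂ) :
    oddTheta τ (x + y) * oddTheta τ (x - y) =
      evenPart τ x * oddPart τ y - oddPart τ x * evenPart τ y := by
  have i0 : Function.Injective (fun k : ℤ => 2 * k) := fun a b h => by simpa using h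
  have i1 : Function.Injective (fun k : ℤ => 2 * k + 1) := fun a b h => by simpa using h
  have s0 : ∀ x, Summable (fun k : ℤ => quadTerm τ x (2 * k)) := fun x =>
    (summable_quadTerm τ x).comp_injective i0
  have s1 : ∀ x, Summable (fun k : ℤ => quadTerm τ x (2 * k + 1)) := fun x =>
    (summable_quadTerm τ x).comp_injective i1
  have prod : ∀ {f g : ℤ → ℂ}, Summable f → Summable g →
      HasSum (fun p : ℤ × ℤ => f p.1 * g p.2) ((∑' k, f k) * ∑' k, g k) := fun hf hg =>
    hf.hasSum.mul hg.hasSum (summable_mul_of_summable_norm hf.norm hg.norm)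
  have hT := prod (hasSum_oddTheta τ (x + y)).summable (hasSum_oddTheta τ (x - y)).summable
  rw [(hasSum_oddTheta τ (x + y)).tsum_eq, (hasSum_oddTheta τ (x - y)).tsum_eq] at hT
  -- `f0` parametrises the pairs with odd sum, `f1` those with even sum.
  let f0 : ℤ × ℤ → ℤ × ℤ := fun p => (p.1 + p.2, p.1 - p.2 - 1)
  let f1 : ℤ × ℤ → ℤ × ℤ := fun p => (p.1 + p.2, p.1 - p.2)
  have j0 : Function.Injective f0 := by
    rintro ⟨a, b⟩ ⟨c, d⟩ h
    simp only [f0, Prod.mk.injEq] at h ⊢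
    omega
  have j1 : Function.Injective f1 := by
    rintro ⟨a, b⟩ ⟨c, d⟩ h
    simp only [f1, Prod.mk.injEq] at h ⊢
    omega
  have hc : IsCompl (Set.range f0) (Set.range f1) := by
    refine ⟨Set.disjoint_left.2 ?_, codisjoint_iff.2 (Set.eq_univ_iff_forall.2 ?_)⟩
    · rintro _ ⟨⟨a, b⟩, rfl⟩ ⟨⟨c, d⟩, h⟩
      simp only [f0, f1, Prod.mk.injEq] at h
      omega
    · rintro ⟨m, n⟩
      rcases Int.even_or_odd' (m + n) with ⟨k, h | h⟩
      · refine Or.inr ⟨(k, m - k), ?_⟩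
        simp only [f1, Prod.mk.injEq]
        omega
      · refine Or.inl ⟨(k + 1, m - k - 1), ?_⟩
        simp only [f0, Prod.mk.injEq]
        omega
  let G : ℤ × ℤ → ℂ := fun p => oddThetaTerm τ (x + y) p.1 * oddThetaTerm τ (x - y) p.2
  refine hT.unique ?_
  rw [sub_eq_add_neg (evenPart _ _ * _)]
  refine HasSum.add_isCompl (a := evenPart τ x * oddPart τ y)
    (b := -(oddPart τ x * evenPart τ y)) hc ?_ ?_
  · refine (j0.hasSum_range_iff (f := G)).2 ((prod (s0 x) (s1 y)).of_eq (fun ⟨k, l⟩ => ?_) rfl)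
    simp only [Function.comp_apply, G, f0, oddThetaTerm_mul]
    rw [show k + l + (k - l - 1) + 1 = 2 * k by ring,
      show k + l - (k - l - 1) = 2 * l + 1 by ring,
      show Real.pi * I * ((2 * k : ℤ) : ℂ) = k * (2 * Real.pi * I) by push_cast; ring,
      exp_int_mul_two_pi_mul_I, one_mul]
  · refine (j1.hasSum_range_iff (f := G)).2 ((prod (s1 x) (s0 y)).neg.of_eq (fun ⟨k, l⟩ => ?_) rfl)
    simp only [Function.comp_apply, G, f1, oddThetaTerm_mul]
    rw [show k + l + (k - l) + 1 = 2 * k + 1 by ring, show k + l - (k - l) = 2 * l by ring,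
      show Real.pi * I * ((2 * k + 1 : ℤ) : ℂ) = 2 * Real.pi * I * (k + 1 / 2) by push_cast; ring,
      exp_half_int_mul, neg_one_mul]

/-- The three-term (Weierstrass) identity. -/
theorem oddTheta_three_term (τ : UpperHalfPlane) (x y u v : ℂ) :
    oddTheta τ (x + y) * oddTheta τ (x - y) * (oddTheta τ (u + v) * oddTheta τ (u - v)) =
      oddTheta τ (x + u) * oddTheta τ (x - u) * (oddTheta τ (y + v) * oddTheta τ (y - v)) -
      oddTheta τ (x + v) * oddTheta τ (x - v) * (oddTheta τ (y + u) * oddTheta τ (y - u)) := by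
  -- Each product is now a 2 × 2 minor in the even and odd parts, and the claim is the Plücker
  -- relation.
  simp only [oddTheta_mul]
  ring

/-! ### Zeros of the odd theta function -/

/-- Otherwise the Fourier series of exp(−πix) t(x) on [0, 1] would vanish, but its zeroth
coefficient is an exponential. -/
theorem exists_oddTheta_ne_zero (τ : UpperHalfPlane) : ∃ z, oddTheta τ z ≠ 0 := by
  by_contra! hT
  have hterm : ∀ (n : ℤ) (x : ℝ), exp (-(Real.pi * I * x)) * oddThetaTerm τ x n =
      oddThetaTerm τ 0 n * exp (2 * Real.pi * I * n * x) := fun n x => by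
    simp only [oddThetaTerm, ← exp_add]
    congr 1
    ring
  have hnorm : ∀ (n : ℤ) (x : ℝ), ‖exp (2 * Real.pi * I * n * x)‖ = 1 := fun n x => by
    rw [show 2 * Real.pi * I * n * x = ((2 * Real.pi * n * x : ℝ) : ℂ) * I by push_cast; ring,
      norm_exp_ofReal_mul_I]
  have hs : Summable fun n => ‖oddThetaTerm τ 0 n‖ := (hasSum_oddTheta τ 0).summable.norm
  have h := intervalIntegral.hasSum_integral_of_dominated_convergence (a := 0) (b := 1)
    (μ := MeasureTheory.volume) (f := fun _ => (0 : ℂ))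
    (F := fun (n : ℤ) (x : ℝ) => oddThetaTerm τ 0 n * exp (2 * Real.pi * I * n * x))
    (fun n _ => ‖oddThetaTerm τ 0 n‖)
    (fun n => Continuous.aestronglyMeasurable (by fun_prop))
    (fun n => .of_forall fun x _ => by rw [norm_mul, hnorm, mul_one])
    (.of_forall fun _ _ => hs) (by simp)
    (.of_forall fun x _ => by
      have h := (hasSum_oddTheta τ x).mul_left (exp (-(Real.pi * I * x)))
      rw [hT, mul_zero] at h
      exact h.of_eq (fun n => (hterm n x).symm) rfl)
  have h0 : ∀ n : ℤ, n ≠ 0 →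
      ∫ x : ℝ in (0 : ℝ)..1, oddThetaTerm τ 0 n * exp (2 * Real.pi * I * n * x) = 0 := by
    intro n hn
    rw [intervalIntegral.integral_const_mul, integral_exp_mul_complex
      (mul_ne_zero two_pi_I_ne_zero (Int.cast_ne_zero.2 hn))]
    rw [show 2 * Real.pi * I * n * ((1 : ℝ) : ℂ) = n * (2 * Real.pi * I) by push_cast; ring,
      exp_int_mul_two_pi_mul_I]
    simp
  have h1 := (hasSum_single 0 h0).unique h
  simp [oddThetaTerm] at h1

/-- The quotient e · exp(−kx) / t is constant near y; the identity theorem does the rest. -/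
theorem eq_const_mul_exp_mul {e t : ℂ → ℂ} (he : Differentiable ℂ e) (ht : Differentiable ℂ t)
    {y : ℂ} (hy : t y ≠ 0) {k : ℂ}
    (h : ∀ x, deriv e x * t x - e x * deriv t x = k * (e x * t x)) :
    ∃ K, ∀ x, e x = K * exp (k * x) * t x := by
  obtain ⟨r, hr, hball⟩ := Metric.eventually_nhds_iff_ball.1
    (ht.continuous.continuousAt.eventually_ne hy)
  have hd : ∀ x ∈ Metric.ball y r, HasDerivAt (fun x => e x * exp (-k * x) / t x) 0 x := by
    intro x hx
    have h1 : HasDerivAt (fun x => exp (-k * x)) (exp (-k * x) * (-k * 1)) x :=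
      ((hasDerivAt_id x).const_mul (-k)).cexp
    refine (((he x).hasDerivAt.mul h1).div (ht x).hasDerivAt (hball x hx)).congr_deriv ?_
    refine div_eq_zero_iff.2 (Or.inl ?_)
    simp only [Pi.mul_apply]
    linear_combination exp (-k * x) * h x
  refine ⟨e y * exp (-k * y) / t y, fun x => ?_⟩
  refine congrFun (AnalyticOnNhd.eq_of_eventuallyEq (𝕜 := ℂ) (z₀ := y)
    (g := fun x => e y * exp (-k * y) / t y * exp (k * x) * t x)
    (he.differentiableOn.analyticOnNhd isOpen_univ)
    (Differentiable.differentiableOn (by fun_prop) |>.analyticOnNhd isOpen_univ) ?_) x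
  filter_upwards [Metric.ball_mem_nhds y hr] with x hx
  have := Metric.isOpen_ball.is_const_of_deriv_eq_zero (convex_ball y r).isPreconnected
    (fun z hz => (hd z hz).differentiableAt.differentiableWithinAt) (fun z hz => (hd z hz).deriv)
    (Metric.mem_ball_self hr) hx
  rw [this]
  have ht := hball x hx
  have : exp (-k * x) * exp (k * x) = 1 := by rw [← exp_add]; simp
  rw [neg_mul] at this ⊢
  field_simp
  linear_combination -e x * this

/-- The zeros of the odd theta function lie in the period lattice. -/
theorem oddTheta_eq_zero {τ : UpperHalfPlane} {c : ℂ} (hc : oddTheta τ c = 0) :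
    ∃ m n : ℤ, c = m + n * τ := by
  have hdt := differentiable_oddTheta τ
  obtain ⟨z₀, hz₀⟩ := exists_oddTheta_ne_zero τ
  set t := oddTheta τ with htdef
  set e : ℂ → ℂ := fun x => t (x + c) with hedef
  have hde : Differentiable ℂ e := hdt.comp (differentiable_id.add_const c)
  obtain ⟨y, hey, hty⟩ : ∃ y, e y ≠ 0 ∧ t y ≠ 0 := by
    by_contra! hcon
    have hne := hdt.continuous.continuousAt.eventually_ne hz₀
    have : e = fun _ => 0 := AnalyticOnNhd.eq_of_eventuallyEq (𝕜 := ℂ) (z₀ := z₀)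
      (hde.differentiableOn.analyticOnNhd isOpen_univ) analyticOnNhd_const (by
        filter_upwards [hne] with x hx
        by_contra hx'
        exact hx (hcon x hx'))
    have := congrFun this (z₀ - c)
    simp only [hedef, sub_add_cancel] at this
    exact hz₀ this
  have hrel : ∀ x h, e x * e y * (t (x + h) * t (y - h)) = e (x + h) * e (y - h) * (t x * t y) := by
    intro x h
    -- These arguments make c the difference of the first and third, so one of the three terms
    -- contains t(c) = 0.
    have h3 := oddTheta_three_term τ ((x + y) / 2 + c) ((x - y) / 2) ((x + y) / 2)
      ((x - y) / 2 + h)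
    rw [← htdef] at h3
    have e1 : (x + y) / 2 + c - (x + y) / 2 = c := by ring
    have e2 : (x - y) / 2 - (x + y) / 2 = -y := by ring
    have e3 : (x - y) / 2 + (x + y) / 2 = x := by ring
    have e4 : (x + y) / 2 + c + (x - y) / 2 = x + c := by ring
    have e5 : (x + y) / 2 + c - (x - y) / 2 = y + c := by ring
    have e6 : (x + y) / 2 + ((x - y) / 2 + h) = x + h := by ring
    have e7 : (x + y) / 2 - ((x - y) / 2 + h) = y - h := by ring
    have e8 : (x + y) / 2 + c + ((x - y) / 2 + h) = x + h + c := by ring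
    have e9 : (x + y) / 2 + c - ((x - y) / 2 + h) = y - h + c := by ring
    rw [e1, e2, e3, e4, e5, e6, e7, e8, e9, hc, htdef, oddTheta_neg] at h3
    simp only [hedef, htdef]
    linear_combination h3
  -- The derivative of `hrel` at h = 0: e'/e − t'/t does not depend on the point.
  have hode : ∀ x, deriv e x * t x - e x * deriv t x =
      (deriv e y * t y - e y * deriv t y) / (e y * t y) * (e x * t x) := by
    intro x
    have d1 : ∀ {f : ℂ → ℂ}, Differentiable ℂ f →
        HasDerivAt (fun h => f (x + h) * f (y - h)) (deriv f x * f y - f x * deriv f y) 0 := by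
      intro f hf
      have := (HasDerivAt.comp_const_add x 0 (hf (x + 0)).hasDerivAt).mul
        (HasDerivAt.comp_const_sub y 0 (hf (y - 0)).hasDerivAt)
      simp only [add_zero, sub_zero] at this
      exact this.congr_deriv (by ring)
    have l := (d1 hdt).const_mul (e x * e y)
    have r := (d1 hde).mul_const (t x * t y)
    rw [funext (hrel x)] at l
    have := l.unique r
    field_simp
    linear_combination -this
  obtain ⟨K, hK⟩ := eq_const_mul_exp_mul hde hdt hty hode
  set k := (deriv e y * t y - e y * deriv t y) / (e y * t y)
  have hey' : K * exp (k * y) * t y ≠ 0 := hK y ▸ hey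
  -- Translating e = K exp(kx) t by the periods 1 and τ forces k ∈ 2πiℤ and then places c in the
  -- lattice.
  have p1 : exp k = 1 := by
    have h1 : e (y + 1) = -e y := by
      simp only [hedef]
      rw [show y + 1 + c = y + c + 1 by ring, htdef, oddTheta_add_one]
    rw [hK, hK, htdef, oddTheta_add_one, ← htdef, mul_add, exp_add, mul_one] at h1
    exact mul_left_cancel₀ hey' (by linear_combination -h1)
  have p2 : exp (-(2 * Real.pi * I * c)) = exp (k * τ) := by
    have h1 : e (y + τ) = -exp (-(Real.pi * I * τ) - 2 * Real.pi * I * (y + c)) * e y := by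
      simp only [hedef]
      rw [show y + τ + c = y + c + τ by ring, htdef, oddTheta_add_tau]
    rw [hK, hK, htdef, oddTheta_add_tau, ← htdef, mul_add, exp_add,
      show -(Real.pi * I * (τ : ℂ)) - 2 * Real.pi * I * (y + c) =
        (-(Real.pi * I * (τ : ℂ)) - 2 * Real.pi * I * y) + -(2 * Real.pi * I * c) by ring,
      exp_add _ (-(2 * Real.pi * I * c))] at h1
    exact mul_left_cancel₀ (mul_ne_zero (exp_ne_zero (-(Real.pi * I * (τ : ℂ)) - 2 * Real.pi * I * y))
      hey') (by linear_combination h1)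
  obtain ⟨n, hn⟩ := exp_eq_one_iff.1 p1
  obtain ⟨m, hm⟩ := exp_eq_exp_iff_exists_int.1 p2
  refine ⟨-m, -n, mul_left_cancel₀ two_pi_I_ne_zero ?_⟩
  rw [hn] at hm
  push_cast
  linear_combination -hm

theorem oddTheta_ofReal_ne_zero (τ : UpperHalfPlane) {c : ℝ} (hc : ∀ m : ℤ, c ≠ m) :
    oddTheta τ c ≠ 0 := by
  intro h
  obtain ⟨m, n, hmn⟩ := oddTheta_eq_zero h
  have him := congrArg Complex.im hmn
  simp only [ofReal_im, add_im, intCast_im, mul_im, intCast_re, zero_mul, zero_add, add_zero,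
    UpperHalfPlane.coe_im] at him
  have hn : (n : ℝ) = 0 := by
    rcases mul_eq_zero.1 him.symm with h | h
    · exact h
    · exact absurd h τ.im_pos.ne'
  have hn' : n = 0 := by exact_mod_cast hn
  rw [hn', Int.cast_zero, zero_mul, add_zero] at hmn
  exact hc m (by exact_mod_cast hmn)

/-! ### Differentiated forms of the three-term identity -/

/-- Second derivative in u, at u = 0, of the identity with v = 0. -/
theorem oddTheta_logDeriv_sub (τ : UpperHalfPlane) (a b : ℂ) :
    oddTheta τ (a + b) * oddTheta τ (a - b) * deriv (oddTheta τ) 0 ^ 2 =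
      (deriv (deriv (oddTheta τ)) a * oddTheta τ a - deriv (oddTheta τ) a ^ 2) *
        oddTheta τ b ^ 2 -
      (deriv (deriv (oddTheta τ)) b * oddTheta τ b - deriv (oddTheta τ) b ^ 2) *
        oddTheta τ a ^ 2 := by
  have hT := differentiable_oddTheta τ
  have hT' : Differentiable ℂ (deriv (oddTheta τ)) :=
    differentiableOn_univ.1 (hT.differentiableOn.deriv isOpen_univ)
  have h3 := fun u => oddTheta_three_term τ a b u 0
  simp only [add_zero, sub_zero] at h3
  have h0 := oddTheta_zero τ
  set t := oddTheta τ
  have dp : ∀ {f g : ℂ → ℂ} (x u : ℂ), Differentiable ℂ f → Differentiable ℂ g →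
      HasDerivAt (fun u => f (x + u) * g (x - u))
        (deriv f (x + u) * g (x - u) - f (x + u) * deriv g (x - u)) u := by
    intro f g x u hf hg
    exact ((HasDerivAt.comp_const_add x u (hf (x + u)).hasDerivAt).mul
        (HasDerivAt.comp_const_sub x u (hg (x - u)).hasDerivAt)).congr_deriv (by ring)
  have d1 : ∀ u, t (a + b) * t (a - b) * (2 * (deriv t u * t u)) =
      (deriv t (a + u) * t (a - u) - t (a + u) * deriv t (a - u)) * (t b * t b) -
      t a * t a * (deriv t (b + u) * t (b - u) - t (b + u) * deriv t (b - u)) := by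
    intro u
    have l := ((hT u).hasDerivAt.mul (hT u).hasDerivAt).const_mul (t (a + b) * t (a - b))
    have r := ((dp a u hT hT).mul_const (t b * t b)).sub ((dp b u hT hT).const_mul (t a * t a))
    have := l.unique (r.congr_of_eventuallyEq (.of_forall h3))
    linear_combination this
  have l := (((hT' 0).hasDerivAt.mul (hT 0).hasDerivAt).const_mul 2).const_mul
    (t (a + b) * t (a - b))
  have r := ((((dp a 0 hT' hT).sub (dp a 0 hT hT')).mul_const (t b * t b))).sub
    (((dp b 0 hT' hT).sub (dp b 0 hT hT')).const_mul (t a * t a))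
  have := l.unique (r.congr_of_eventuallyEq (.of_forall d1))
  simp only [add_zero, sub_zero, h0] at this
  linear_combination this / 2

/-- First derivative in h, at h = 0, of the identity at (2a, 0, a + h, a − h). -/
theorem oddTheta_triple (τ : UpperHalfPlane) (a : ℂ) :
    oddTheta τ (2 * a) ^ 3 * deriv (oddTheta τ) 0 =
      3 * deriv (oddTheta τ) a * oddTheta τ a ^ 2 * oddTheta τ (3 * a) -
        deriv (oddTheta τ) (3 * a) * oddTheta τ a ^ 3 := by
  have hT := differentiable_oddTheta τ
  have h3 : ∀ h, oddTheta τ (2 * a) ^ 3 * oddTheta τ (h + h) =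
      oddTheta τ (3 * a - h) * oddTheta τ (a + h) ^ 3 -
      oddTheta τ (3 * a + h) * oddTheta τ (a - h) ^ 3 := by
    intro h
    have := oddTheta_three_term τ (2 * a) 0 (a + h) (a - h)
    rw [show 2 * a - (a + h) = a - h by ring, show 2 * a - (a - h) = a + h by ring,
      show a + h + (a - h) = 2 * a by ring, show a + h - (a - h) = h + h by ring,
      show 2 * a + (a + h) = 3 * a + h by ring, show 2 * a + (a - h) = 3 * a - h by ring,
      zero_add, zero_sub, zero_add, zero_sub, oddTheta_neg, oddTheta_neg, add_zero,
      sub_zero] at this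
    linear_combination this
  set t := oddTheta τ
  have dp : ∀ x, HasDerivAt (fun h => t (x + h)) (deriv t x) 0 := fun x => by
    simpa using HasDerivAt.comp_const_add x 0 (hT (x + 0)).hasDerivAt
  have dm : ∀ x, HasDerivAt (fun h => t (x - h)) (-deriv t x) 0 := fun x => by
    simpa using HasDerivAt.comp_const_sub x 0 (hT (x - 0)).hasDerivAt
  have d0 : HasDerivAt (fun h => t (h + h)) (deriv t 0 * (1 + 1)) 0 := by
    have := HasDerivAt.comp (h := fun h : ℂ => h + h) (0 : ℂ) (hT ((0 : ℂ) + 0)).hasDerivAt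
      ((hasDerivAt_id (0 : ℂ)).add (hasDerivAt_id (0 : ℂ)))
    rw [add_zero] at this
    exact this
  have l := d0.const_mul (t (2 * a) ^ 3)
  have r := ((dm (3 * a)).mul ((dp a).pow 3)).sub ((dp (3 * a)).mul ((dm a).pow 3))
  have := l.unique (r.congr_of_eventuallyEq (.of_forall h3))
  simp only [add_zero, sub_zero, Pi.pow_apply] at this
  push_cast at this
  linear_combination this / 2

/-! ### Evaluation at the fifths -/

theorem deriv_oddTheta_neg (τ : UpperHalfPlane) (z : ℂ) :
    deriv (oddTheta τ) (-z) = deriv (oddTheta τ) z := by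
  have h := deriv_comp_neg (oddTheta τ) z
  simp only [oddTheta_neg] at h
  rw [deriv.fun_neg, neg_inj] at h
  exact h.symm

theorem deriv_deriv_oddTheta_neg (τ : UpperHalfPlane) (z : ℂ) :
    deriv (deriv (oddTheta τ)) (-z) = -deriv (deriv (oddTheta τ)) z := by
  have h := deriv_comp_neg (deriv (oddTheta τ)) z
  simp only [deriv_oddTheta_neg] at h
  exact (neg_eq_iff_eq_neg.2 h).symm

theorem deriv_oddTheta_add_one (τ : UpperHalfPlane) (z : ℂ) :
    deriv (oddTheta τ) (z + 1) = -deriv (oddTheta τ) z := by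
  rw [← deriv_comp_add_const]
  simp only [oddTheta_add_one]
  rw [deriv.fun_neg]

theorem thetaDeriv2_one_eq (τ : UpperHalfPlane) (e : ℝ) :
    thetaDeriv2 1 e τ = deriv (deriv (oddTheta τ)) (((e : ℂ) - 1) / 2) := by
  simp only [thetaDeriv2, thetaChar_one_eq]
  rw [iteratedDeriv_comp_add_const, iteratedDeriv_succ, iteratedDeriv_one]
  simp only [zero_add]

theorem mainTheorem11 (τ : UpperHalfPlane) :
    thetaConst 1 (1 / 5) τ ≠ 0 ∧ thetaConst 1 (3 / 5) τ ≠ 0 ∧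
    thetaDeriv2 1 (1 / 5) τ / thetaConst 1 (1 / 5) τ
        - thetaDeriv2 1 (3 / 5) τ / thetaConst 1 (3 / 5) τ =
      thetaDeriv 1 1 τ ^ 2 /
          (100 * thetaConst 1 (1 / 5) τ ^ 6 * thetaConst 1 (3 / 5) τ ^ 6) *
        (-8 * thetaConst 1 (1 / 5) τ ^ 10
          + 88 * thetaConst 1 (1 / 5) τ ^ 5 * thetaConst 1 (3 / 5) τ ^ 5
          + 8 * thetaConst 1 (3 / 5) τ ^ 10) := by
  have hA : oddTheta τ (1 / 5) ≠ 0 := by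
    have := oddTheta_ofReal_ne_zero τ (c := 1 / 5) fun m hm => by
      have : (1 : ℝ) = ((5 * m : ℤ) : ℝ) := by push_cast; linarith
      have : (1 : ℤ) = 5 * m := by exact_mod_cast this
      omega
    simpa using this
  have hB : oddTheta τ (2 / 5) ≠ 0 := by
    have := oddTheta_ofReal_ne_zero τ (c := 2 / 5) fun m hm => by
      have : (2 : ℝ) = ((5 * m : ℤ) : ℝ) := by push_cast; linarith
      have : (2 : ℤ) = 5 * m := by exact_mod_cast this
      omega
    simpa using this
  have eB : (((1 / 5 : ℝ) : ℂ) - 1) / 2 = -(2 / 5) := by push_cast; norm_num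
  have eA : (((3 / 5 : ℝ) : ℂ) - 1) / 2 = -(1 / 5) := by push_cast; norm_num
  have cB : thetaConst 1 (1 / 5) τ = -oddTheta τ (2 / 5) := by
    rw [thetaConst, thetaChar_one_eq, eB, zero_add, oddTheta_neg]
  have cA : thetaConst 1 (3 / 5) τ = -oddTheta τ (1 / 5) := by
    rw [thetaConst, thetaChar_one_eq, eA, zero_add, oddTheta_neg]
  have c0 : thetaDeriv 1 1 τ = deriv (oddTheta τ) 0 := rfl
  rw [thetaDeriv2_one_eq, thetaDeriv2_one_eq, cA, cB, c0, eA, eB, deriv_deriv_oddTheta_neg,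
    deriv_deriv_oddTheta_neg]
  refine ⟨neg_ne_zero.2 hB, neg_ne_zero.2 hA, ?_⟩
  have r1 := oddTheta_logDeriv_sub τ (2 / 5) (1 / 5)
  have r2 := oddTheta_triple τ (1 / 5)
  have r3 := oddTheta_triple τ (2 / 5)
  rw [show (2 / 5 + 1 / 5 : ℂ) = 1 - 2 / 5 by norm_num, oddTheta_one_sub,
    show (2 / 5 - 1 / 5 : ℂ) = 1 / 5 by norm_num] at r1
  rw [show (2 * (1 / 5) : ℂ) = 2 / 5 by norm_num, show (3 * (1 / 5) : ℂ) = -(2 / 5) + 1 by norm_num,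
    deriv_oddTheta_add_one, oddTheta_add_one, deriv_oddTheta_neg, oddTheta_neg, neg_neg] at r2
  rw [show (2 * (2 / 5) : ℂ) = 1 - 1 / 5 by norm_num, show (3 * (2 / 5) : ℂ) = 1 / 5 + 1 by norm_num,
    deriv_oddTheta_add_one, oddTheta_add_one, oddTheta_one_sub] at r3
  generalize oddTheta τ (1 / 5) = A at *
  generalize oddTheta τ (2 / 5) = B at *
  generalize deriv (deriv (oddTheta τ)) (1 / 5) = A2 at *
  generalize deriv (deriv (oddTheta τ)) (2 / 5) = B2 at *
  generalize deriv (oddTheta τ) (1 / 5) = A1 at *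
  generalize deriv (oddTheta τ) (2 / 5) = B1 at *
  generalize deriv (oddTheta τ) 0 = D at *
  -- `s1` and `s2` form a linear system of determinant 10 in A1/A and B1/B; squaring its solution
  -- produces the 100.
  have s1 : 3 * (A1 / A) + B1 / B = D * B ^ 2 / A ^ 3 := by
    field_simp
    linear_combination -r2
  have s2 : 3 * (B1 / B) - A1 / A = -(D * A ^ 2 / B ^ 3) := by
    field_simp
    linear_combination r3
  have s3 : B2 / B - A2 / A = D ^ 2 / (A * B) + (B1 / B) ^ 2 - (A1 / A) ^ 2 := by
    field_simp
    linear_combination -r1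
  have sA : A1 / A = (3 * (D * B ^ 2 / A ^ 3) + D * A ^ 2 / B ^ 3) / 10 := by
    linear_combination (3 * s1 - s2) / 10
  have sB : B1 / B = (D * B ^ 2 / A ^ 3 - 3 * (D * A ^ 2 / B ^ 3)) / 10 := by
    linear_combination (s1 + 3 * s2) / 10
  rw [neg_div_neg_eq, neg_div_neg_eq, s3, sA, sB]
  field_simp
  ring
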